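/- **Theorem 3.4.** Let $S$ be a semifield, i.e. a commutative semiring with $0$ and $1$ such that $(S\setminus\{0\},\cdot,1)$ is a group, and let $\Gamma=(V,E,s,r)$ be an arbitrary directed graph with vertex set $V$, edge set $E$ and source and range maps $s,r:E\to V$. A vertex $v$ is *regular* if $0<|s^{-1}(v)|<\infty$. The Leavitt path algebra $L_S(\Gamma)$ is the (associative, not necessarily unital) $S$-algebra presented by the generators $v$ ($v\in V$), $e$, $e^*$ ($e\in E$) and the relations 1. $vv'=\delta_{v,v'}v$ for $v,v'\in V$; 2. $s(e)e=e=e\,r(e)$ and $r(e)e^*=e^*=e^*s(e)$ for $e\in E$; 3. $e^*f=\delta_{e,f}\,r(e)$ for $e,f\in E$; 4. $v=\sum_{e\in s^{-1}(v)}ee^*$ for every regular vertex $v\in V$. An *ideal* of $L_S(\Gamma)$ is a submonoid $I$ of $(L_S(\Gamma),+,0)$ such that $xa\in I$ and $ax\in I$ for all $a\in I$, $x\in L_S(\Gamma)$; and $L_S(\Gamma)$ is *ideal-simple* if $0$ and $L_S(\Gamma)$ are its only ideals. Then $L_S(\Gamma)$ is ideal-simple if and only if the following two conditions hold: (1) the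 only hereditary and saturated subsets of $V$ are $\varnothing$ and $V$, where $H\subseteq V$ is *hereditary* if $s(e)\in H$ implies $r(e)\in H$ for all $e\in E$, and *saturated* if $v\in H$ for every regular vertex $v$ with $r(s^{-1}(v))\subseteq H$; (2) every cycle in $\Gamma$ has an exit. Here a *cycle* is a sequence of edges $e_1,\dots,e_n$, $n\ge 1$, with $r(e_i)=s(e_{i+1})$ for $1\le i<n$, $r(e_n)=s(e_1)$, and $s(e_1),\dots,s(e_n)$ pairwise distinct; an *exit* for it is an edge $f$ such that $s(f)=s(e_i)$ and $f\ne e_i$ for some $i$. -/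

import Mathlib

/-- A directed graph with vertex set `V`, edge set `E`, and source and range maps
`s r : E → V`.  There is no finiteness or countability assumption. -/
structure DirectedGraph (V : Type*) (E : Type*) where
  /-- the source of an edge -/
  s : E → V
  /-- the range (end vertex) of an edge -/
  r : E → V

namespace DirectedGraph

variable {V E : Type*} (Γ : DirectedGraph V E)

/-- A vertex is regular if the set of edges starting at it is nonempty and finite. -/
def IsRegular (v : V) : Prop :=
  (Γ.s ⁻¹' {v}).Nonempty ∧ (Γ.s ⁻¹' {v}).Finite

/-- `H` is hereditary if `s e ∈ H` implies `r e ∈ H` for every edge `e`. -/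
def IsHereditary (H : Set V) : Prop :=
  ∀ e : E, Γ.s e ∈ H → Γ.r e ∈ H

/-- `H` is saturated if it contains every regular vertex `v` with `r(s⁻¹(v)) ⊆ H`. -/
def IsSaturated (H : Set V) : Prop :=
  ∀ v : V, Γ.IsRegular v → Γ.r '' (Γ.s ⁻¹' {v}) ⊆ H → v ∈ H

/-- A list of edges `e₁, …, eₙ` is a path (of positive length) if `n ≥ 1` and
`r eᵢ = s eᵢ₊₁` for `1 ≤ i < n`. -/
def IsPath (p : List E) : Prop :=
  p ≠ [] ∧ p.IsChain (fun e f => Γ.r e = Γ.s f)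

/-- A cycle is a path `e₁, …, eₙ`, `n ≥ 1`, that is closed, `r eₙ = s e₁`, and whose
vertices `s e₁, …, s eₙ` are pairwise distinct. -/
def IsCycle (p : List E) : Prop :=
  Γ.IsPath p ∧ (∀ hp : p ≠ [], Γ.r (p.getLast hp) = Γ.s (p.head hp)) ∧ (p.map Γ.s).Nodup

/-- The edge `f` is an exit for `e₁, …, eₙ` if `s f = s eᵢ` and `f ≠ eᵢ` for some `i`. -/
def IsExit (f : E) (p : List E) : Prop :=
  ∃ e ∈ p, Γ.s f = Γ.s e ∧ f ≠ e

end DirectedGraph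

/-- The set of generators: the disjoint union of `V`, `E` and a copy `E*` of `E`. -/
inductive LeavittGen (V : Type*) (E : Type*) where
  | vertex (v : V) : LeavittGen V E
  | edge (e : E) : LeavittGen V E
  | ghost (e : E) : LeavittGen V E

/-- The free (associative, not necessarily unital) `S`-algebra on a set `X`: polynomials
without constant term in the noncommuting variables `X`. -/
abbrev FreeNonUnitalAlg (S : Type*) [CommSemiring S] (X : Type*) :=
  MonoidAlgebra S (FreeSemigroup X)

/-- The variable `x` as an element of the free algebra. -/
noncomputable def FreeNonUnitalAlg.of (S : Type*) [CommSemiring S] {X : Type*} (x : X) :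
    FreeNonUnitalAlg S X :=
  MonoidAlgebra.single (FreeSemigroup.of x) 1

section Leavitt

variable (S : Type*) [CommSemiring S] {V E : Type*} (Γ : DirectedGraph V E)

open FreeNonUnitalAlg LeavittGen in
/-- The defining relations of the Leavitt path algebra. -/
inductive LeavittRel :
    FreeNonUnitalAlg S (LeavittGen V E) → FreeNonUnitalAlg S (LeavittGen V E) → Prop
  | vertex_mul_self (v : V) :
      LeavittRel (of S (vertex v) * of S (vertex v)) (of S (vertex v))
  | vertex_mul_of_ne (v w : V) (h : v ≠ w) :
      LeavittRel (of S (vertex v) * of S (vertex w)) 0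
  | source_mul_edge (e : E) :
      LeavittRel (of S (vertex (Γ.s e)) * of S (edge e)) (of S (edge e))
  | edge_mul_range (e : E) :
      LeavittRel (of S (edge e) * of S (vertex (Γ.r e))) (of S (edge e))
  | range_mul_ghost (e : E) :
      LeavittRel (of S (vertex (Γ.r e)) * of S (ghost e)) (of S (ghost e))
  | ghost_mul_source (e : E) :
      LeavittRel (of S (ghost e) * of S (vertex (Γ.s e))) (of S (ghost e))
  | ghost_mul_edge_self (e : E) :
      LeavittRel (of S (ghost e) * of S (edge e)) (of S (vertex (Γ.r e)))
  | ghost_mul_edge_of_ne (e f : E) (h : e ≠ f) :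
      LeavittRel (of S (ghost e) * of S (edge f)) 0
  | vertex_eq_sum (v : V) (h : Γ.IsRegular v) :
      LeavittRel (of S (vertex v))
        (∑ e ∈ h.2.toFinset, of S (edge e) * of S (ghost e))

/-- The congruence of `S`-algebras generated by the defining relations: the smallest
equivalence relation that contains them and is compatible with addition,
multiplication and scalar multiplication. -/
inductive LeavittCongr :
    FreeNonUnitalAlg S (LeavittGen V E) → FreeNonUnitalAlg S (LeavittGen V E) → Prop
  | of {a b} (h : LeavittRel S Γ a b) : LeavittCongr a b
  | refl (a) : LeavittCongr a a
  | symm {a b} (h : LeavittCongr a b) : LeavittCongr b a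
  | trans {a b c} (h : LeavittCongr a b) (h' : LeavittCongr b c) : LeavittCongr a c
  | add {a b c d} (h : LeavittCongr a b) (h' : LeavittCongr c d) :
      LeavittCongr (a + c) (b + d)
  | mul {a b c d} (h : LeavittCongr a b) (h' : LeavittCongr c d) :
      LeavittCongr (a * c) (b * d)
  | smul (k : S) {a b} (h : LeavittCongr a b) : LeavittCongr (k • a) (k • b)

/-- The generated congruence, bundled. -/
def leavittCon : RingCon (FreeNonUnitalAlg S (LeavittGen V E)) where
  r := LeavittCongr S Γ
  iseqv := ⟨LeavittCongr.refl, LeavittCongr.symm, LeavittCongr.trans⟩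
  add' := LeavittCongr.add
  mul' := LeavittCongr.mul

/-- The Leavitt path algebra `L_S(Γ)` with coefficients in the commutative semiring `S`:
the quotient of the free `S`-algebra on `V ∪ E ∪ E*` by the congruence generated by the
defining relations.  It need not be unital. -/
def LeavittPathAlgebra : Type _ := (leavittCon S Γ).Quotient

namespace LeavittPathAlgebra

noncomputable instance : NonUnitalSemiring (LeavittPathAlgebra S Γ) :=
  inferInstanceAs (NonUnitalSemiring (leavittCon S Γ).Quotient)

/-- The quotient map from the free algebra. -/
noncomputable def mk (a : FreeNonUnitalAlg S (LeavittGen V E)) : LeavittPathAlgebra S Γ :=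
  (leavittCon S Γ).toQuotient a

noncomputable instance : SMul S (LeavittPathAlgebra S Γ) where
  smul k := Quotient.map' (fun a => k • a) (fun _ _ h => LeavittCongr.smul k h)

noncomputable instance : Module S (LeavittPathAlgebra S Γ) where
  one_smul := by rintro ⟨a⟩; exact congrArg (mk S Γ) (one_smul S a)
  mul_smul k l := by rintro ⟨a⟩; exact congrArg (mk S Γ) (mul_smul k l a)
  smul_zero k := congrArg (mk S Γ) (smul_zero k)
  smul_add k := by rintro ⟨a⟩ ⟨b⟩; exact congrArg (mk S Γ) (smul_add k a b)
  add_smul k l := by rintro ⟨a⟩; exact congrArg (mk S Γ) (add_smul k l a)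
  zero_smul := by rintro ⟨a⟩; exact congrArg (mk S Γ) (zero_smul S a)

instance : IsScalarTower S (LeavittPathAlgebra S Γ) (LeavittPathAlgebra S Γ) where
  smul_assoc k := by rintro ⟨a⟩ ⟨b⟩; exact congrArg (mk S Γ) (smul_mul_assoc k a b)

instance : SMulCommClass S (LeavittPathAlgebra S Γ) (LeavittPathAlgebra S Γ) where
  smul_comm k := by rintro ⟨a⟩ ⟨b⟩; exact congrArg (mk S Γ) (mul_smul_comm k a b).symm

end LeavittPathAlgebra

end Leavitt

/-- An ideal of a hemiring `A` (Mathlib: `NonUnitalSemiring`) is a submonoid of `(A, +, 0)`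
that absorbs multiplication by elements of `A` from both sides. -/
def IsHemiringIdeal {A : Type*} [NonUnitalSemiring A] (I : AddSubmonoid A) : Prop :=
  ∀ x : A, ∀ a ∈ I, x * a ∈ I ∧ a * x ∈ I

/-- A hemiring `A` is ideal-simple if `0` and `A` are its only ideals. -/
def IsIdealSimple (A : Type*) [NonUnitalSemiring A] : Prop :=
  ∀ I : AddSubmonoid A, IsHemiringIdeal I → I = ⊥ ∨ I = ⊤

/-! Sufficiency. Every element is a combination of terms `p q*`. Multiplying a nonzero element of an
ideal on the right by edges shortens the ghost parts; when all these products vanish, some component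
`x v` is nonzero and already free of ghost edges (`exists_mul_vert_ne_zero`). So a nonzero ideal
contains a nonzero combination of paths. Multiplying by `p*` for a shortest path `p` occurring in it
gives `k w` plus multiples of closed paths at `w`. Subtraction is not available, so the closed paths
are killed one at a time: an exit yields a path `p` with `p* t p = 0` for a given closed path `t`,
and conjugation by `p` preserves the shape of the sum (`exists_vert_mem_of_add_sum_mem`). Once none
is left, inverting `k` puts a vertex into the ideal. The vertices in an ideal form a hereditary
saturated set, hence all of them lie in it.

Necessity. Branching systems give representations on functions with values in `S[T;T⁻¹]`, where `T`
records path length. For `H` hereditary and saturated, a system supported outside `H` has a kernel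
that contains exactly the vertices of `H`. For a cycle `c` of length `n` without exit, based at `v`,
there is a system in which `v + c` acts as `(1 + T ^ n) v`. The elements whose image consists of
multiples of `1 + T ^ n` form an ideal that contains `v + c ≠ 0` but not `v`, because `1 + T ^ n` is
not a unit. The system for `H = ∅` also provides the linear independence of paths needed for
sufficiency. -/

namespace DirectedGraph

/-! ### Walks -/

variable {V E : Type*} (Γ : DirectedGraph V E)

/-- `Γ.IsWalk v l w`: the list of edges `l` is a (possibly trivial) path from `v` to `w`. -/
inductive IsWalk : V → List E → V → Prop
  | nil (v : V) : IsWalk v [] v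
  | cons (e : E) {l : List E} {w : V} (h : IsWalk (Γ.r e) l w) : IsWalk (Γ.s e) (e :: l) w

variable {Γ}

theorem isWalk_nil_iff {v w : V} : Γ.IsWalk v [] w ↔ v = w :=
  ⟨fun h => by cases h; rfl, fun h => h ▸ .nil v⟩

theorem isWalk_cons_iff {v w : V} {e : E} {l : List E} :
    Γ.IsWalk v (e :: l) w ↔ Γ.s e = v ∧ Γ.IsWalk (Γ.r e) l w :=
  ⟨fun h => by cases h; exact ⟨rfl, by assumption⟩, fun h => h.1 ▸ .cons e h.2⟩

theorem isWalk_append_iff {v w : V} {l m : List E} :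
    Γ.IsWalk v (l ++ m) w ↔ ∃ u, Γ.IsWalk v l u ∧ Γ.IsWalk u m w := by
  induction l generalizing v with
  | nil => simp [isWalk_nil_iff]
  | cons e l ih => simp only [List.cons_append, isWalk_cons_iff, ih]; tauto

theorem IsWalk.end_unique {v w w' : V} {l : List E} (h : Γ.IsWalk v l w)
    (h' : Γ.IsWalk v l w') : w = w' := by
  induction h with
  | nil v => exact isWalk_nil_iff.1 h'
  | cons e h ih => exact ih (isWalk_cons_iff.1 h').2

end DirectedGraph

/-! ### Monomials and the filtration by ghost degree -/

namespace LeavittPathAlgebra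

section Basic

variable (S : Type*) [CommSemiring S] {V E : Type*} (Γ : DirectedGraph V E)

/-- The vertex `v` as an element of the Leavitt path algebra. -/
noncomputable def vert (v : V) : LeavittPathAlgebra S Γ :=
  mk S Γ (FreeNonUnitalAlg.of S (.vertex v))

/-- The edge `e` as an element of the Leavitt path algebra. -/
noncomputable def edge (e : E) : LeavittPathAlgebra S Γ :=
  mk S Γ (FreeNonUnitalAlg.of S (.edge e))

/-- The ghost edge `e*` as an element of the Leavitt path algebra. -/
noncomputable def ghost (e : E) : LeavittPathAlgebra S Γ :=
  mk S Γ (FreeNonUnitalAlg.of S (.ghost e))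

theorem mk_eq {a b : FreeNonUnitalAlg S (LeavittGen V E)} (h : LeavittRel S Γ a b) :
    mk S Γ a = mk S Γ b :=
  Quotient.sound (LeavittCongr.of h)

theorem mk_sum {ι : Type*} (F : Finset ι) (f : ι → FreeNonUnitalAlg S (LeavittGen V E)) :
    mk S Γ (∑ i ∈ F, f i) = ∑ i ∈ F, mk S Γ (f i) :=
  map_sum (⟨⟨mk S Γ, rfl⟩, fun _ _ => rfl⟩ :
    FreeNonUnitalAlg S (LeavittGen V E) →+ LeavittPathAlgebra S Γ) f F

@[simp] theorem vert_mul_self (v : V) : vert S Γ v * vert S Γ v = vert S Γ v :=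
  mk_eq S Γ (.vertex_mul_self v)

theorem vert_mul_of_ne {v w : V} (h : v ≠ w) : vert S Γ v * vert S Γ w = 0 :=
  mk_eq S Γ (.vertex_mul_of_ne v w h)

@[simp] theorem source_mul_edge (e : E) : vert S Γ (Γ.s e) * edge S Γ e = edge S Γ e :=
  mk_eq S Γ (.source_mul_edge e)

@[simp] theorem edge_mul_range (e : E) : edge S Γ e * vert S Γ (Γ.r e) = edge S Γ e :=
  mk_eq S Γ (.edge_mul_range e)

@[simp] theorem range_mul_ghost (e : E) : vert S Γ (Γ.r e) * ghost S Γ e = ghost S Γ e :=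
  mk_eq S Γ (.range_mul_ghost e)

@[simp] theorem ghost_mul_source (e : E) : ghost S Γ e * vert S Γ (Γ.s e) = ghost S Γ e :=
  mk_eq S Γ (.ghost_mul_source e)

@[simp] theorem ghost_mul_edge_self (e : E) : ghost S Γ e * edge S Γ e = vert S Γ (Γ.r e) :=
  mk_eq S Γ (.ghost_mul_edge_self e)

theorem ghost_mul_edge_of_ne {e f : E} (h : e ≠ f) : ghost S Γ e * edge S Γ f = 0 :=
  mk_eq S Γ (.ghost_mul_edge_of_ne e f h)

theorem vert_eq_sum {v : V} (h : Γ.IsRegular v) :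
    vert S Γ v = ∑ e ∈ h.2.toFinset, edge S Γ e * ghost S Γ e :=
  (mk_eq S Γ (.vertex_eq_sum v h)).trans (mk_sum S Γ _ _)

theorem vert_mul_edge_of_ne {v : V} {e : E} (h : v ≠ Γ.s e) : vert S Γ v * edge S Γ e = 0 := by
  rw [← source_mul_edge, ← mul_assoc, vert_mul_of_ne S Γ h, zero_mul]

theorem edge_mul_vert_of_ne {v : V} {e : E} (h : Γ.r e ≠ v) : edge S Γ e * vert S Γ v = 0 := by
  rw [← edge_mul_range, mul_assoc, vert_mul_of_ne S Γ h, mul_zero]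

theorem ghost_mul_vert_of_ne {v : V} {e : E} (h : Γ.s e ≠ v) :
    ghost S Γ e * vert S Γ v = 0 := by
  rw [← ghost_mul_source, mul_assoc, vert_mul_of_ne S Γ h, mul_zero]

/-- The product `e₁ ⋯ eₙ w`. -/
noncomputable def pathElt (l : List E) (w : V) : LeavittPathAlgebra S Γ :=
  l.foldr (fun e x => edge S Γ e * x) (vert S Γ w)

/-- The product `w eₙ* ⋯ e₁*`. -/
noncomputable def ghostElt (l : List E) (w : V) : LeavittPathAlgebra S Γ :=
  l.foldr (fun e x => x * ghost S Γ e) (vert S Γ w)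

@[simp] theorem pathElt_nil (w : V) : pathElt S Γ [] w = vert S Γ w := rfl

@[simp] theorem pathElt_cons (e : E) (l : List E) (w : V) :
    pathElt S Γ (e :: l) w = edge S Γ e * pathElt S Γ l w := rfl

@[simp] theorem ghostElt_nil (w : V) : ghostElt S Γ [] w = vert S Γ w := rfl

@[simp] theorem ghostElt_cons (e : E) (l : List E) (w : V) :
    ghostElt S Γ (e :: l) w = ghostElt S Γ l w * ghost S Γ e := rfl

@[simp] theorem pathElt_mul_vert (l : List E) (w : V) :
    pathElt S Γ l w * vert S Γ w = pathElt S Γ l w := by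
  induction l with
  | nil => simp
  | cons e l ih => simp [mul_assoc, ih]

theorem pathElt_mul_vert_of_ne (l : List E) {w v : V} (h : w ≠ v) :
    pathElt S Γ l w * vert S Γ v = 0 := by
  rw [← pathElt_mul_vert, mul_assoc, vert_mul_of_ne S Γ h, mul_zero]

theorem pathElt_mul_edge (l : List E) (e : E) :
    pathElt S Γ l (Γ.s e) * edge S Γ e = pathElt S Γ (l ++ [e]) (Γ.r e) := by
  induction l with
  | nil => simp
  | cons f l ih => simp [mul_assoc, ih]

theorem pathElt_mul_edge_of_ne (l : List E) {w : V} {e : E} (h : w ≠ Γ.s e) :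
    pathElt S Γ l w * edge S Γ e = 0 := by
  rw [← pathElt_mul_vert, mul_assoc, vert_mul_edge_of_ne S Γ h, mul_zero]

variable {Γ} in
theorem vert_mul_pathElt {l : List E} {v w : V} (h : Γ.IsWalk v l w) :
    vert S Γ v * pathElt S Γ l w = pathElt S Γ l w := by
  cases h with
  | nil => simp
  | cons e h => simp [← mul_assoc]

variable {Γ} in
theorem pathElt_mul_pathElt {l m : List E} {v w : V} (h : Γ.IsWalk v m w) :
    pathElt S Γ l v * pathElt S Γ m w = pathElt S Γ (l ++ m) w := by
  induction l with
  | nil => exact vert_mul_pathElt S h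
  | cons e l ih => simp [mul_assoc, ih]

theorem pathElt_eq_zero_or (l : List E) (w : V) :
    pathElt S Γ l w = 0 ∨ ∃ v, Γ.IsWalk v l w := by
  induction l with
  | nil => exact .inr ⟨w, .nil w⟩
  | cons e l ih =>
    rcases ih with ih | ⟨v, ih⟩
    · simp [ih]
    · by_cases h : Γ.r e = v
      · subst h; exact .inr ⟨_, .cons e ih⟩
      · left
        rw [pathElt_cons, ← vert_mul_pathElt S ih, ← mul_assoc, edge_mul_vert_of_ne S Γ h,
          zero_mul]

theorem ghostElt_mul_vert (l : List E) (w v : V) :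
    ghostElt S Γ l w * vert S Γ v = 0 ∨ ghostElt S Γ l w * vert S Γ v = ghostElt S Γ l w := by
  cases l with
  | nil =>
    by_cases h : w = v
    · subst h; simp
    · exact .inl (vert_mul_of_ne S Γ h)
  | cons e l =>
    rw [ghostElt_cons, mul_assoc]
    by_cases h : Γ.s e = v
    · subst h; simp
    · simp [ghost_mul_vert_of_ne S Γ h]

variable {Γ} in
theorem ghostElt_mul_pathElt_append {l m : List E} {v u w : V} (hl : Γ.IsWalk v l u)
    (hm : Γ.IsWalk u m w) :
    ghostElt S Γ l u * pathElt S Γ (l ++ m) w = pathElt S Γ m w := by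
  induction hl with
  | nil v => exact vert_mul_pathElt S hm
  | cons e h ih =>
    rw [ghostElt_cons, List.cons_append, pathElt_cons, mul_assoc, ← mul_assoc (ghost S Γ e),
      ghost_mul_edge_self, vert_mul_pathElt S (DirectedGraph.isWalk_append_iff.2 ⟨_, h, hm⟩),
      ih hm]

-- Equal first edges cancel until two edges differ, or until the ghost part is exhausted at a wrong
-- vertex. The length bound prevents a ghost path from surviving.
variable {Γ} in
theorem ghostElt_mul_pathElt_of_not_prefix {l m : List E} {v v' u w : V} (hl : Γ.IsWalk v l u)
    (hm : Γ.IsWalk v' m w) (hlen : l.length ≤ m.length) (h : v ≠ v' ∨ ¬ l <+: m) :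
    ghostElt S Γ l u * pathElt S Γ m w = 0 := by
  induction hl generalizing m v' with
  | nil v =>
    have hv : v ≠ v' := by simpa using h
    rw [← vert_mul_pathElt S hm, ghostElt_nil, ← mul_assoc, vert_mul_of_ne S Γ hv, zero_mul]
  | cons e hl ih =>
    cases hm with
    | nil => simp at hlen
    | cons f hm =>
      rw [ghostElt_cons, pathElt_cons, mul_assoc, ← mul_assoc (ghost S Γ e)]
      by_cases hef : e = f
      · subst hef
        rw [ghost_mul_edge_self, vert_mul_pathElt S hm]
        exact ih hm (by simpa using hlen) (.inr (by simpa using h))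
      · rw [ghost_mul_edge_of_ne S Γ hef, zero_mul, mul_zero]

theorem ghost_mul_ghostElt (e : E) (l : List E) :
    ghost S Γ e * ghostElt S Γ l (Γ.s e) = ghostElt S Γ (l ++ [e]) (Γ.r e) := by
  induction l with
  | nil => simp
  | cons f l ih => simp [← mul_assoc, ih]

/-- The span of the elements `p q*` with `q` of length at most `n`. -/
noncomputable def ghostDegreeLE (n : ℕ) : Submodule S (LeavittPathAlgebra S Γ) :=
  Submodule.span S {x | ∃ l l' : List E, ∃ w : V, l'.length ≤ n ∧
    x = pathElt S Γ l w * ghostElt S Γ l' w}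

theorem pathElt_mul_ghostElt_mem {n : ℕ} (l : List E) {l' : List E} (w : V)
    (h : l'.length ≤ n) : pathElt S Γ l w * ghostElt S Γ l' w ∈ ghostDegreeLE S Γ n :=
  Submodule.subset_span ⟨l, l', w, h, rfl⟩

theorem pathElt_mem (n : ℕ) (l : List E) (w : V) : pathElt S Γ l w ∈ ghostDegreeLE S Γ n := by
  simpa using pathElt_mul_ghostElt_mem S Γ l (l' := []) w (Nat.zero_le n)

theorem ghostDegreeLE_mono {m n : ℕ} (h : m ≤ n) : ghostDegreeLE S Γ m ≤ ghostDegreeLE S Γ n :=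
  Submodule.span_mono fun _ ⟨l, l', w, hl, hx⟩ => ⟨l, l', w, hl.trans h, hx⟩

-- The edge cancels the last ghost edge or kills the term. For `n = 0` the truncated subtraction is
-- right: a path times an edge is a path or zero.
variable {S Γ} in
theorem mul_edge_mem {n : ℕ} {x : LeavittPathAlgebra S Γ} (hx : x ∈ ghostDegreeLE S Γ n) (e : E) :
    x * edge S Γ e ∈ ghostDegreeLE S Γ (n - 1) := by
  induction hx using Submodule.span_induction with
  | mem x h =>
    obtain ⟨l, l', w, hl, rfl⟩ := h
    cases l' with
    | nil =>
      rw [ghostElt_nil, pathElt_mul_vert]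
      by_cases h : w = Γ.s e
      · subst h; rw [pathElt_mul_edge]; exact pathElt_mem S Γ _ _ _
      · rw [pathElt_mul_edge_of_ne S Γ l h]; exact zero_mem _
    | cons f l' =>
      rw [ghostElt_cons, mul_assoc, mul_assoc]
      by_cases h : f = e
      · subst h
        rw [ghost_mul_edge_self]
        rcases ghostElt_mul_vert S Γ l' w (Γ.r f) with h | h <;> rw [h]
        · simp
        · exact pathElt_mul_ghostElt_mem S Γ l w (Nat.le_sub_one_of_lt hl)
      · simp [ghost_mul_edge_of_ne S Γ h]
  | zero => simp
  | add x y _ _ hx hy => rw [add_mul]; exact add_mem hx hy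
  | smul k x _ hx => rw [smul_mul_assoc]; exact Submodule.smul_mem _ k hx

variable {S Γ} in
/-- Induction principle: `L_S(Γ)` is spanned by words in the generators. -/
theorem gen_induction {p : LeavittPathAlgebra S Γ → Prop} (x : LeavittPathAlgebra S Γ)
    (zero : p 0) (add : ∀ x y, p x → p y → p (x + y)) (smul : ∀ (k : S) x, p x → p (k • x))
    (gen : ∀ g : LeavittGen V E, p (mk S Γ (FreeNonUnitalAlg.of S g)))
    (mul : ∀ (g : LeavittGen V E) y, p y → p (mk S Γ (FreeNonUnitalAlg.of S g) * y)) : p x := by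
  obtain ⟨a, rfl⟩ : ∃ a, mk S Γ a = x := Quotient.exists_rep x
  induction a using MonoidAlgebra.induction_linear with
  | zero => exact zero
  | add a b ha hb => exact add _ _ ha hb
  | single w k =>
    have key : p (mk S Γ (MonoidAlgebra.single w 1)) := by
      induction w using FreeSemigroup.recOnMul with
      | ih1 g => exact gen g
      | ih2 g w _ hw =>
        have := mul g _ hw
        have h2 : (MonoidAlgebra.single (FreeSemigroup.of g * w) 1 :
            FreeNonUnitalAlg S (LeavittGen V E)) =
            FreeNonUnitalAlg.of S g * MonoidAlgebra.single w 1 := by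
          simp [FreeNonUnitalAlg.of, MonoidAlgebra.single_mul_single]
        rw [h2]; exact this
    have := smul k _ key
    have h2 : (MonoidAlgebra.single w k : FreeNonUnitalAlg S (LeavittGen V E)) =
        k • MonoidAlgebra.single w 1 := by simp
    rw [h2]; exact this

/-- A generator on the left of `p q*` either acts on `p` or, if it is a ghost edge and `p` is
trivial, lengthens `q*` by one. -/
theorem exists_mem_ghostDegreeLE (x : LeavittPathAlgebra S Γ) : ∃ n, x ∈ ghostDegreeLE S Γ n := by
  induction x using gen_induction with
  | zero => exact ⟨0, zero_mem _⟩
  | add x y hx hy =>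
    obtain ⟨m, hm⟩ := hx
    obtain ⟨n, hn⟩ := hy
    exact ⟨max m n, add_mem (ghostDegreeLE_mono S Γ (le_max_left m n) hm)
      (ghostDegreeLE_mono S Γ (le_max_right m n) hn)⟩
  | smul k x hx => exact hx.imp fun n hn => Submodule.smul_mem _ k hn
  | gen g =>
    cases g with
    | vertex v => exact ⟨0, pathElt_mem S Γ 0 [] v⟩
    | edge e =>
      refine ⟨0, ?_⟩
      change edge S Γ e ∈ _
      have := pathElt_mem S Γ 0 [e] (Γ.r e)
      simpa using this
    | ghost e =>
      refine ⟨1, ?_⟩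
      change ghost S Γ e ∈ _
      have := pathElt_mul_ghostElt_mem S Γ (n := 1) [] (l' := [e]) (Γ.r e) le_rfl
      simpa using this
  | mul g x hx =>
    obtain ⟨n, hn⟩ := hx
    refine ⟨n + 1, ?_⟩
    induction hn using Submodule.span_induction with
    | zero => simp
    | add x y _ _ hx hy => rw [mul_add]; exact add_mem hx hy
    | smul k x _ hx => rw [mul_smul_comm]; exact Submodule.smul_mem _ k hx
    | mem x h =>
      obtain ⟨l, l', w, hl, rfl⟩ := h
      have hmem (m : List E) : pathElt S Γ m w * ghostElt S Γ l' w ∈ ghostDegreeLE S Γ (n + 1) :=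
        pathElt_mul_ghostElt_mem S Γ m w (hl.trans (Nat.le_succ n))
      cases g with
      | vertex v =>
        change vert S Γ v * _ ∈ _
        rw [← mul_assoc]
        rcases pathElt_eq_zero_or S Γ l w with h | ⟨u, h⟩
        · simp [h]
        · rw [← vert_mul_pathElt S h, ← mul_assoc]
          by_cases hv : v = u
          · subst hv; rw [vert_mul_self, vert_mul_pathElt S h]; exact hmem l
          · simp [vert_mul_of_ne S Γ hv]
      | edge e =>
        change edge S Γ e * _ ∈ _
        rw [← mul_assoc]; exact hmem (e :: l)
      | ghost e =>
        change ghost S Γ e * _ ∈ _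
        cases l with
        | nil =>
          rw [pathElt_nil, ← mul_assoc]
          by_cases h : Γ.s e = w
          · subst h
            rw [ghost_mul_source, ghost_mul_ghostElt]
            have := pathElt_mul_ghostElt_mem S Γ (n := n + 1) [] (l' := l' ++ [e]) (Γ.r e)
              (by simpa using hl)
            rwa [← ghost_mul_ghostElt, pathElt_nil, ← mul_assoc, range_mul_ghost,
              ghost_mul_ghostElt] at this
          · simp [ghost_mul_vert_of_ne S Γ h]
        | cons f l =>
          rw [pathElt_cons, ← mul_assoc, ← mul_assoc]
          by_cases h : e = f
          · subst h
            rw [ghost_mul_edge_self]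
            rcases pathElt_eq_zero_or S Γ l w with h | ⟨u, h⟩
            · simp [h]
            · by_cases hv : Γ.r e = u
              · subst hv; rw [vert_mul_pathElt S h]; exact hmem l
              · rw [← vert_mul_pathElt S h, ← mul_assoc, vert_mul_of_ne S Γ hv]
                simp
          · simp [ghost_mul_edge_of_ne S Γ h]

end Basic

end LeavittPathAlgebra

/-! ### Branching systems and their representations -/

open scoped LaurentPolynomial

/-- A branching system for `Γ`: a set `Y` of abstract boundary paths, where `src y = some v`
means that `y` starts at `v`, `head y = some e` that `y = e · tail y`, and `pre e y` is `e · y`. -/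
structure BranchingSystem {V E : Type*} (Γ : DirectedGraph V E) (Y : Type*) where
  /-- the start vertex, if any -/
  src : Y → Option V
  /-- the first edge, if any -/
  head : Y → Option E
  /-- removal of the first edge -/
  tail : Y → Y
  /-- prefixing an edge -/
  pre : E → Y → Y
  src_pre : ∀ e y, src y = some (Γ.r e) → src (pre e y) = some (Γ.s e)
  head_pre : ∀ e y, src y = some (Γ.r e) → head (pre e y) = some e
  tail_pre : ∀ e y, src y = some (Γ.r e) → tail (pre e y) = y
  src_of_head : ∀ e y, head y = some e → src y = some (Γ.s e)
  src_tail : ∀ e y, head y = some e → src (tail y) = some (Γ.r e)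
  pre_tail : ∀ e y, head y = some e → pre e (tail y) = y
  head_ne_none : ∀ v y, Γ.IsRegular v → src y = some v → head y ≠ none

namespace BranchingSystem

variable {V E : Type*} {Γ : DirectedGraph V E} {Y : Type*} (B : BranchingSystem Γ Y)
variable (S : Type*) [CommSemiring S]

open scoped Classical in
/-- The action of the generators on functions on a branching system. -/
noncomputable def genAct : LeavittGen V E → Module.End S[T;T⁻¹] (Y → S[T;T⁻¹])
  | .vertex v =>
    { toFun f y := if B.src y = some v then f y else 0
      map_add' f g := by ext1 y; by_cases h : B.src y = some v <;> simp [h]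
      map_smul' k f := by ext1 y; by_cases h : B.src y = some v <;> simp [h] }
  | .edge e =>
    { toFun f y := if B.head y = some e then LaurentPolynomial.T 1 * f (B.tail y) else 0
      map_add' f g := by ext1 y; by_cases h : B.head y = some e <;> simp [h, mul_add]
      map_smul' k f := by
        ext1 y; by_cases h : B.head y = some e <;> simp [h, mul_left_comm] }
  | .ghost e =>
    { toFun f y := if B.src y = some (Γ.r e) then LaurentPolynomial.T (-1) * f (B.pre e y) else 0
      map_add' f g := by ext1 y; by_cases h : B.src y = some (Γ.r e) <;> simp [h, mul_add]
      map_smul' k f := by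
        ext1 y; by_cases h : B.src y = some (Γ.r e) <;> simp [h, mul_left_comm] }

open scoped Classical in
theorem genAct_vertex (v : V) (f : Y → S[T;T⁻¹]) (y : Y) :
    B.genAct S (.vertex v) f y = if B.src y = some v then f y else 0 := rfl

open scoped Classical in
theorem genAct_edge (e : E) (f : Y → S[T;T⁻¹]) (y : Y) :
    B.genAct S (.edge e) f y =
      if B.head y = some e then LaurentPolynomial.T 1 * f (B.tail y) else 0 := rfl

open scoped Classical in
theorem genAct_ghost (e : E) (f : Y → S[T;T⁻¹]) (y : Y) :
    B.genAct S (.ghost e) f y =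
      if B.src y = some (Γ.r e) then LaurentPolynomial.T (-1) * f (B.pre e y) else 0 := rfl

/-- The action of the free algebra on functions on a branching system. -/
noncomputable def freeRep :
    FreeNonUnitalAlg S (LeavittGen V E) →ₙₐ[S] Module.End S[T;T⁻¹] (Y → S[T;T⁻¹]) :=
  MonoidAlgebra.liftMagma S (FreeSemigroup.lift (B.genAct S))

@[simp] theorem freeRep_of (g : LeavittGen V E) :
    B.freeRep S (FreeNonUnitalAlg.of S g) = B.genAct S g := by
  simp [freeRep, FreeNonUnitalAlg.of, MonoidAlgebra.liftMagma]

theorem freeRep_rel {a b : FreeNonUnitalAlg S (LeavittGen V E)} (h : LeavittRel S Γ a b) :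
    B.freeRep S a = B.freeRep S b := by
  classical
  cases h with
  | vertex_mul_self v =>
    refine LinearMap.ext fun f => funext fun y => ?_
    simp only [map_mul, freeRep_of, Module.End.mul_apply, genAct_vertex]
    split_ifs <;> rfl
  | vertex_mul_of_ne v w hvw =>
    refine LinearMap.ext fun f => funext fun y => ?_
    simp only [map_mul, freeRep_of, Module.End.mul_apply, genAct_vertex, map_zero,
      LinearMap.zero_apply, Pi.zero_apply]
    split_ifs with h1 h2
    · exact absurd (Option.some.inj (h1.symm.trans h2)) hvw
    · rfl
    · rfl
  | source_mul_edge e =>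
    refine LinearMap.ext fun f => funext fun y => ?_
    simp only [map_mul, freeRep_of, Module.End.mul_apply, genAct_vertex, genAct_edge]
    split_ifs with h1 h2 h2
    · rfl
    · rfl
    · exact absurd (B.src_of_head e y h2) h1
    · rfl
  | edge_mul_range e =>
    refine LinearMap.ext fun f => funext fun y => ?_
    simp only [map_mul, freeRep_of, Module.End.mul_apply, genAct_vertex, genAct_edge]
    split_ifs with h1 h2
    · rfl
    · exact absurd (B.src_tail e y h1) h2
    · rfl
  | range_mul_ghost e =>
    refine LinearMap.ext fun f => funext fun y => ?_
    simp only [map_mul, freeRep_of, Module.End.mul_apply, genAct_vertex, genAct_ghost]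
    split_ifs <;> rfl
  | ghost_mul_source e =>
    refine LinearMap.ext fun f => funext fun y => ?_
    simp only [map_mul, freeRep_of, Module.End.mul_apply, genAct_vertex, genAct_ghost]
    split_ifs with h1 h2
    · rfl
    · exact absurd (B.src_pre e y h1) h2
    · rfl
  | ghost_mul_edge_self e =>
    refine LinearMap.ext fun f => funext fun y => ?_
    simp only [map_mul, freeRep_of, Module.End.mul_apply, genAct_vertex, genAct_ghost, genAct_edge]
    split_ifs with h1 h2
    · rw [← mul_assoc, ← LaurentPolynomial.T_add, B.tail_pre e y h1]
      simp
    · exact absurd (B.head_pre e y h1) h2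
    · rfl
  | ghost_mul_edge_of_ne e e' hne =>
    refine LinearMap.ext fun f => funext fun y => ?_
    simp only [map_mul, freeRep_of, Module.End.mul_apply, genAct_ghost, genAct_edge, map_zero,
      LinearMap.zero_apply, Pi.zero_apply]
    split_ifs with h1 h2
    · rw [B.head_pre e y h1] at h2
      exact absurd (Option.some.inj h2) hne
    · simp
    · rfl
  | vertex_eq_sum v hv =>
    refine LinearMap.ext fun f => funext fun y => ?_
    have key (e : E) : (B.genAct S (.edge e) * B.genAct S (.ghost e)) f y =
        if B.head y = some e then f y else 0 := by
      simp only [Module.End.mul_apply, genAct_edge, genAct_ghost]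
      split_ifs with h1 h2
      · rw [B.pre_tail e y h1, ← mul_assoc, ← LaurentPolynomial.T_add]
        simp
      · exact absurd (B.src_tail e y h1) h2
      · rfl
    simp only [map_sum, map_mul, freeRep_of, LinearMap.sum_apply, Finset.sum_apply, key,
      genAct_vertex]
    split_ifs with h
    -- A point over a regular vertex has exactly one first edge, so exactly one summand survives.
    · obtain ⟨e, he⟩ := Option.ne_none_iff_exists'.1 (B.head_ne_none v y hv h)
      have hs : Γ.s e = v := Option.some.inj ((B.src_of_head e y he).symm.trans h)
      rw [Finset.sum_eq_single e]
      · simp [he]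
      · intro e' _ hne
        rw [he, if_neg]
        exact fun h' => hne (Option.some.inj h').symm
      · intro hmem
        exact absurd (by simpa using hs) hmem
    · symm
      refine Finset.sum_eq_zero fun e he => if_neg fun h' => h ?_
      have hs : Γ.s e = v := by simpa using he
      rw [← hs]
      exact B.src_of_head e y h'

theorem freeRep_congr {a b : FreeNonUnitalAlg S (LeavittGen V E)} (h : LeavittCongr S Γ a b) :
    B.freeRep S a = B.freeRep S b := by
  induction h with
  | of h => exact B.freeRep_rel S h
  | refl => rfl
  | symm _ ih => exact ih.symm
  | trans _ _ ih ih' => exact ih.trans ih'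
  | add _ _ ih ih' => rw [map_add, map_add, ih, ih']
  | mul _ _ ih ih' => rw [map_mul, map_mul, ih, ih']
  | smul k _ ih => rw [map_smul, map_smul, ih]

/-- The representation of the Leavitt path algebra on functions on a branching system. -/
noncomputable def rep :
    LeavittPathAlgebra S Γ →ₙₐ[S] Module.End S[T;T⁻¹] (Y → S[T;T⁻¹]) where
  toFun := Quotient.lift (B.freeRep S) fun _ _ h => B.freeRep_congr S h
  map_smul' k := by rintro ⟨a⟩; exact map_smul (B.freeRep S) k a
  map_zero' := map_zero (B.freeRep S)
  map_add' := by rintro ⟨a⟩ ⟨b⟩; exact map_add (B.freeRep S) a b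
  map_mul' := by rintro ⟨a⟩ ⟨b⟩; exact map_mul (B.freeRep S) a b

theorem rep_mk (a : FreeNonUnitalAlg S (LeavittGen V E)) :
    B.rep S (LeavittPathAlgebra.mk S Γ a) = B.freeRep S a := rfl

open scoped Classical in
theorem rep_vert (v : V) (f : Y → S[T;T⁻¹]) (y : Y) :
    B.rep S (LeavittPathAlgebra.vert S Γ v) f y = if B.src y = some v then f y else 0 := by
  rw [LeavittPathAlgebra.vert, rep_mk, freeRep_of, genAct_vertex]

open scoped Classical in
theorem rep_edge (e : E) (f : Y → S[T;T⁻¹]) (y : Y) :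
    B.rep S (LeavittPathAlgebra.edge S Γ e) f y =
      if B.head y = some e then LaurentPolynomial.T 1 * f (B.tail y) else 0 := by
  rw [LeavittPathAlgebra.edge, rep_mk, freeRep_of, genAct_edge]

/-- Prefixing a path. -/
def preList (l : List E) (y : Y) : Y := l.foldr B.pre y

@[simp] theorem preList_nil (y : Y) : B.preList [] y = y := rfl

@[simp] theorem preList_cons (e : E) (l : List E) (y : Y) :
    B.preList (e :: l) y = B.pre e (B.preList l y) := rfl

theorem src_preList {l : List E} {v w : V} (h : Γ.IsWalk v l w) {y : Y} (hy : B.src y = some w) :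
    B.src (B.preList l y) = some v := by
  induction h with
  | nil => exact hy
  | cons e h ih => exact B.src_pre _ _ (ih hy)

theorem rep_pathElt_preList {l : List E} {v w : V} (h : Γ.IsWalk v l w) {y : Y}
    (hy : B.src y = some w) (f : Y → S[T;T⁻¹]) :
    B.rep S (LeavittPathAlgebra.pathElt S Γ l w) f (B.preList l y) =
      LaurentPolynomial.T l.length * f y := by
  induction h with
  | nil => simp [rep_vert, hy]
  | cons e h ih =>
    have := B.src_preList h hy
    rw [LeavittPathAlgebra.pathElt_cons, map_mul, Module.End.mul_apply, rep_edge, preList_cons,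
      if_pos (B.head_pre _ _ this), B.tail_pre _ _ this, ih hy, ← mul_assoc,
      ← LaurentPolynomial.T_add]
    simp [add_comm]

theorem rep_pathElt_preList_of_ne {l l' : List E} {v v' w w' : V} (h : Γ.IsWalk v l w)
    (h' : Γ.IsWalk v' l' w') (hlen : l'.length = l.length) (hne : l' ≠ l) {y : Y}
    (hy : B.src y = some w) (f : Y → S[T;T⁻¹]) :
    B.rep S (LeavittPathAlgebra.pathElt S Γ l' w') f (B.preList l y) = 0 := by
  induction h generalizing v' l' with
  | nil => simp at hlen; simp [hlen] at hne
  | cons e h ih =>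
    cases h' with
    | nil => simp at hlen
    | cons e' h' =>
      have := B.src_preList h hy
      rw [LeavittPathAlgebra.pathElt_cons, map_mul, Module.End.mul_apply, rep_edge, preList_cons,
        B.head_pre _ _ this, B.tail_pre _ _ this]
      by_cases he : e = e'
      · subst he
        rw [if_pos rfl, ih h' (by simpa using hlen) (by simpa using hne) hy, mul_zero]
      · rw [if_neg (by simpa using he)]

/-- The exponent of `T` is the length of the path, so paths of different lengths are told apart by
coefficients. -/
theorem rep_pathElt_one (l : List E) (w : V) (y : Y) :
    B.rep S (LeavittPathAlgebra.pathElt S Γ l w) 1 y = 0 ∨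
      B.rep S (LeavittPathAlgebra.pathElt S Γ l w) 1 y = LaurentPolynomial.T l.length := by
  induction l generalizing y with
  | nil => by_cases h : B.src y = some w <;> simp [rep_vert, h]
  | cons e l ih =>
    rw [LeavittPathAlgebra.pathElt_cons, map_mul, Module.End.mul_apply, rep_edge]
    split_ifs
    · rcases ih (B.tail y) with h | h <;> rw [h]
      · simp
      · right; rw [← LaurentPolynomial.T_add]; simp [add_comm]
    · simp

end BranchingSystem

/-! ### Existence of branching systems -/

section Quotient

universe u

/-- The summand `ℕ` makes `E ⊕ ℕ` infinite, and it is at least as large as `F`. Hence for nonempty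
`F` it is in bijection with `F × (E ⊕ ℕ)`, that is, it splits into copies of itself indexed by `F`.
-/
theorem exists_branching {E : Type u} (F : Set E) :
    ∃ (hd : E ⊕ ℕ → Option E) (tl : E ⊕ ℕ → E ⊕ ℕ) (pre : E → E ⊕ ℕ → E ⊕ ℕ),
      (∀ e ∈ F, ∀ x, hd (pre e x) = some e ∧ tl (pre e x) = x) ∧
      (∀ x e, hd x = some e → e ∈ F ∧ pre e (tl x) = x) ∧
      (F.Nonempty → ∀ x, hd x ≠ none) := by
  classical
  rcases F.eq_empty_or_nonempty with rfl | hF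
  · exact ⟨fun _ => none, id, fun _ => id, by simp, by simp, by simp⟩
  · have hcard : Cardinal.mk (F × (E ⊕ ℕ)) = Cardinal.mk (E ⊕ ℕ) := by
      rw [Cardinal.mk_prod, Cardinal.lift_id, Cardinal.lift_id]
      refine Cardinal.mul_eq_right (Cardinal.aleph0_le_mk _) ?_ ?_
      · exact Cardinal.mk_le_of_injective (f := fun e : F => (Sum.inl e.1 : E ⊕ ℕ))
          fun a b h => Subtype.ext (Sum.inl.inj h)
      · exact Cardinal.mk_ne_zero_iff.2 hF.to_subtype
    obtain ⟨ψ⟩ := Cardinal.eq.1 hcard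
    refine ⟨fun x => some (ψ.symm x).1.1, fun x => (ψ.symm x).2,
      fun e x => if h : e ∈ F then ψ (⟨e, h⟩, x) else x, ?_, ?_, by simp⟩
    · intro e he x
      simp [he]
    · intro x e hx
      obtain rfl := Option.some.inj hx
      simp

/-- For `H` hereditary and saturated there is a branching system supported on the vertices
outside `H`. -/
theorem exists_branchingSystem {V : Type*} {E : Type u} (Γ : DirectedGraph V E) {H : Set V}
    (hH : Γ.IsHereditary H) (hS : Γ.IsSaturated H) :
    ∃ B : BranchingSystem Γ (V × (E ⊕ ℕ)),
      (∀ v ∉ H, ∃ y, B.src y = some v) ∧ ∀ v ∈ H, ∀ y, B.src y ≠ some v := by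
  classical
  -- The fibre over `w` is split according to the edges from `w` that do not lead into `H`; over `H`
  -- there are none, by heredity.
  choose hd tl pre h1 h2 h3 using fun w : V => exists_branching {e | Γ.s e = w ∧ Γ.r e ∉ H}
  have hsrc (v : V) (y : V × (E ⊕ ℕ)) :
      (if y.1 ∈ H then none else some y.1) = some v ↔ y.1 = v ∧ v ∉ H := by
    split_ifs with h
    · simp only [false_iff, not_and, not_not]; rintro rfl; exact h
    · simp only [Option.some.injEq, iff_self_and]; rintro rfl; exact h
  have hsr {e : E} (h : Γ.r e ∉ H) : Γ.s e ∉ H := fun h' => h (hH e h')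
  refine ⟨{ src := fun y => if y.1 ∈ H then none else some y.1
            head := fun y => hd y.1 y.2
            tail := fun y => ((hd y.1 y.2).elim y.1 Γ.r, tl y.1 y.2)
            pre := fun e y => (Γ.s e, pre (Γ.s e) e y.2)
            src_pre := ?_, head_pre := ?_, tail_pre := ?_, src_of_head := ?_, src_tail := ?_
            pre_tail := ?_, head_ne_none := ?_ }, ?_, ?_⟩
  · intro e y h
    rw [hsrc] at h ⊢
    exact ⟨rfl, hsr h.2⟩
  · intro e y h
    rw [hsrc] at h
    exact (h1 _ e ⟨rfl, h.2⟩ _).1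
  · intro e y h
    rw [hsrc] at h
    obtain ⟨h4, h5⟩ := h1 _ e ⟨rfl, h.2⟩ y.2
    ext1
    · simp [h4, h.1]
    · exact h5
  · intro e y h
    rw [hsrc]
    obtain ⟨⟨h4, h5⟩, -⟩ := h2 _ _ _ h
    exact ⟨h4.symm, hsr h5⟩
  · intro e y h
    rw [hsrc]
    obtain ⟨⟨h4, h5⟩, -⟩ := h2 _ _ _ h
    exact ⟨by simp [h], h5⟩
  · intro e y h
    obtain ⟨⟨h4, h5⟩, h6⟩ := h2 _ _ _ h
    ext1
    · exact h4
    · rw [← h4] at h6 ⊢; exact h6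
  · intro v y hv h
    rw [hsrc] at h
    obtain ⟨rfl, h⟩ := h
    refine h3 _ ?_ _
    -- If every edge from the regular vertex led into `H`, saturation would put the vertex itself
    -- into `H`.
    by_contra hne
    refine h (hS _ hv ?_)
    rintro _ ⟨e, he, rfl⟩
    by_contra hr
    exact hne ⟨e, he, hr⟩
  · intro v hv
    exact ⟨(v, .inr 0), (hsrc _ _).2 ⟨rfl, hv⟩⟩
  · intro v hv y h
    exact ((hsrc _ _).1 h).2 hv

end Quotient

/-! ### Closed paths, cycles and exits -/

namespace DirectedGraph

variable {V E : Type*} {Γ : DirectedGraph V E}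

theorem isHereditary_empty : Γ.IsHereditary ∅ := fun _ h => h

theorem isSaturated_empty : Γ.IsSaturated ∅ := fun _ hv h =>
  let ⟨_, he⟩ := hv.1
  (h ⟨_, he, rfl⟩).elim

theorem IsWalk.head_getLast {v w : V} {l : List E} (h : Γ.IsWalk v l w) (hl : l ≠ []) :
    Γ.s (l.head hl) = v ∧ Γ.r (l.getLast hl) = w := by
  induction l generalizing v with
  | nil => exact absurd rfl hl
  | cons e l ih =>
    obtain ⟨h1, h2⟩ := isWalk_cons_iff.1 h
    refine ⟨h1, ?_⟩
    cases l with
    | nil => exact isWalk_nil_iff.1 h2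
    | cons f l => rw [List.getLast_cons (by simp)]; exact (ih h2 (by simp)).2

theorem IsWalk.isChain {v w : V} {l : List E} (h : Γ.IsWalk v l w) :
    l.IsChain (fun e f => Γ.r e = Γ.s f) := by
  induction l generalizing v with
  | nil => exact .nil
  | cons e l ih =>
    have h1 := (isWalk_cons_iff.1 h).2
    cases l with
    | nil => exact .singleton _
    | cons f l => exact .cons_cons (isWalk_cons_iff.1 h1).1.symm (ih h1)

theorem isWalk_of_isChain {l : List E} (hl : l ≠ [])
    (h : l.IsChain (fun e f => Γ.r e = Γ.s f)) :
    Γ.IsWalk (Γ.s (l.head hl)) l (Γ.r (l.getLast hl)) := by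
  induction l with
  | nil => exact absurd rfl hl
  | cons e l ih =>
    cases l with
    | nil => exact .cons e (.nil _)
    | cons f l =>
      rw [List.isChain_cons_cons] at h
      refine .cons e ?_
      rw [h.1, List.getLast_cons (by simp)]
      exact ih (by simp) h.2

theorem exists_split_of_not_nodup {l : List E} (h : ¬ (l.map Γ.s).Nodup) :
    ∃ a e b e' c, l = a ++ (e :: b ++ e' :: c) ∧ Γ.s e = Γ.s e' := by
  induction l with
  | nil => simp at h
  | cons e l ih =>
    rw [List.map_cons, List.nodup_cons, not_and_or, not_not] at h
    rcases h with h | h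
    · obtain ⟨e', he', hs⟩ := List.mem_map.1 h
      obtain ⟨b, c, rfl⟩ := List.append_of_mem he'
      exact ⟨[], e, b, e', c, rfl, hs.symm⟩
    · obtain ⟨a, e₁, b, e', c, rfl, hs⟩ := ih h
      exact ⟨e :: a, e₁, b, e', c, rfl, hs⟩

/-- If two edges have the same source, the segment from the first up to the second is a shorter
closed path. -/
theorem IsWalk.exists_cycle {v : V} {l : List E} (h : Γ.IsWalk v l v) (hl : l ≠ []) :
    ∃ c, Γ.IsCycle c ∧ c ⊆ l := by
  induction hn : l.length using Nat.strong_induction_on generalizing l v with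
  | _ n ih =>
    by_cases hd : (l.map Γ.s).Nodup
    · refine ⟨l, ⟨⟨hl, h.isChain⟩, fun hl' => ?_, hd⟩, List.Subset.refl l⟩
      obtain ⟨h1, h2⟩ := h.head_getLast hl'
      rw [h1, h2]
    · obtain ⟨a, e, b, e', c, rfl, hs⟩ := exists_split_of_not_nodup hd
      obtain ⟨u, -, h2⟩ := isWalk_append_iff.1 h
      obtain ⟨u', h2, h3⟩ := isWalk_append_iff.1 h2
      have hu := (isWalk_cons_iff.1 h2).1
      have hu' := (isWalk_cons_iff.1 h3).1
      have huu : u' = u := by rw [← hu, ← hu', hs]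
      subst huu
      obtain ⟨d, hd, hsub⟩ := ih (e :: b).length (by simp at hn ⊢; omega) h2 (by simp) rfl
      refine ⟨d, hd, fun x hx => ?_⟩
      have := hsub hx
      simp only [List.mem_append]
      tauto

/-- If every cycle has an exit, then every closed path can be left. -/
theorem IsWalk.exists_not_prefix (hexit : ∀ p : List E, Γ.IsCycle p → ∃ f : E, Γ.IsExit f p)
    {v : V} {l : List E} (h : Γ.IsWalk v l v) (hl : l ≠ []) :
    ∃ p u, Γ.IsWalk v p u ∧ ¬ p <+: l ++ p := by
  obtain ⟨c, hc, hsub⟩ := h.exists_cycle hl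
  obtain ⟨f, e, he, hs, hne⟩ := hexit c hc
  obtain ⟨a, b, rfl⟩ := List.append_of_mem (hsub he)
  obtain ⟨u, h1, h2⟩ := isWalk_append_iff.1 h
  -- Follow `l = a e b` up to the edge `e` of the cycle and leave by the exit `f ≠ e`.
  refine ⟨a ++ [f], Γ.r f, isWalk_append_iff.2 ⟨u, h1, ?_⟩, ?_⟩
  · exact isWalk_cons_iff.2 ⟨hs.trans (isWalk_cons_iff.1 h2).1, .nil _⟩
  · rw [List.append_assoc, List.prefix_append_right_inj]
    simp [hne]

end DirectedGraph

/-! ### Independence of paths and elimination of ghost edges -/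

namespace LeavittPathAlgebra

section Independence

variable (S : Type*) [CommSemiring S] {V E : Type*} {Γ : DirectedGraph V E}

/-- There are coefficient functionals for the paths with a given end. -/
theorem exists_coeff {v w : V} {l : List E} (h : Γ.IsWalk v l w) :
    ∃ κ : LeavittPathAlgebra S Γ →ₗ[S] S, κ (pathElt S Γ l w) = 1 ∧
      ∀ l' v', Γ.IsWalk v' l' w → l' ≠ l → κ (pathElt S Γ l' w) = 0 := by
  obtain ⟨B, hB, -⟩ := exists_branchingSystem Γ Γ.isHereditary_empty Γ.isSaturated_empty
  obtain ⟨y, hy⟩ := hB w (Set.notMem_empty w)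
  -- Apply `x` to the constant function `1`, evaluate at the point `l · y`, and read off the
  -- coefficient of `T ^ |l|`. The point separates paths of equal length, the exponent those of
  -- different lengths.
  let κ : LeavittPathAlgebra S Γ →ₗ[S] S :=
    { toFun := fun x => (B.rep S x 1 (B.preList l y)).coeff l.length
      map_add' := fun x y => by simp
      map_smul' := fun k x => by simp }
  have hκ (x) : κ x = (B.rep S x 1 (B.preList l y)).coeff l.length := rfl
  refine ⟨κ, ?_, fun l' v' h' hne => ?_⟩
  · rw [hκ, B.rep_pathElt_preList S h hy]
    simp
  · rw [hκ]
    by_cases hlen : l'.length = l.length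
    · rw [B.rep_pathElt_preList_of_ne S h h' hlen hne hy]
      simp
    · rcases B.rep_pathElt_one S l' w (B.preList l y) with h0 | h0 <;> rw [h0]
      · simp
      · simp [hlen]

theorem vert_ne_zero [Nontrivial S] (v : V) : vert S Γ v ≠ 0 := by
  obtain ⟨κ, h, -⟩ := exists_coeff S (DirectedGraph.IsWalk.nil (Γ := Γ) v)
  intro h0
  rw [pathElt_nil, h0, map_zero] at h
  exact zero_ne_one h

variable {S}

/-- Elements without ghost edges are combinations of paths. -/
theorem exists_finsupp_of_mem {b : LeavittPathAlgebra S Γ} (hb : b ∈ ghostDegreeLE S Γ 0) :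
    ∃ c : {p : List E × V // ∃ v, Γ.IsWalk v p.1 p.2} →₀ S,
      (c.sum fun p k => k • pathElt S Γ p.1.1 p.1.2) = b := by
  rw [← Finsupp.mem_span_range_iff_exists_finsupp]
  refine (Submodule.span_le.2 ?_) hb
  rintro _ ⟨l, l', w, hl, rfl⟩
  obtain rfl := List.length_eq_zero_iff.1 (Nat.le_zero.1 hl)
  rw [ghostElt_nil, pathElt_mul_vert]
  rcases pathElt_eq_zero_or S Γ l w with h | h
  · rw [h]; exact zero_mem _
  · exact Submodule.subset_span ⟨⟨(l, w), h⟩, rfl⟩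

/-- Appending `f` is injective on the paths that end at `s f`, so the coefficients of `b` at these
paths can be read off from `b f`. -/
theorem eq_zero_of_mul_edge_eq_zero {b : LeavittPathAlgebra S Γ}
    (hb : b ∈ ghostDegreeLE S Γ 0) {f : E} (hv : b * vert S Γ (Γ.s f) = b)
    (hf : b * edge S Γ f = 0) : b = 0 := by
  obtain ⟨c, rfl⟩ := exists_finsupp_of_mem hb
  rw [← hv, Finsupp.sum, Finset.sum_mul]
  refine Finset.sum_eq_zero fun p hp => ?_
  rw [smul_mul_assoc]
  by_cases hpv : p.1.2 = Γ.s f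
  swap
  · rw [pathElt_mul_vert_of_ne S Γ _ hpv, smul_zero]
  obtain ⟨v, hw⟩ := p.2
  have hw' : Γ.IsWalk v (p.1.1 ++ [f]) (Γ.r f) :=
    DirectedGraph.isWalk_append_iff.2 ⟨_, hw, hpv ▸ .cons f (.nil _)⟩
  obtain ⟨κ, h1, h2⟩ := exists_coeff S hw'
  have key : κ ((c.sum fun p k => k • pathElt S Γ p.1.1 p.1.2) * edge S Γ f) = c p := by
    rw [Finsupp.sum, Finset.sum_mul, map_sum, Finset.sum_eq_single p]
    · rw [smul_mul_assoc, hpv, pathElt_mul_edge, map_smul, h1, smul_eq_mul, mul_one]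
    · intro q _ hq
      rw [smul_mul_assoc, map_smul]
      by_cases hqv : q.1.2 = Γ.s f
      · obtain ⟨u, hu⟩ := q.2
        rw [hqv, pathElt_mul_edge, h2 _ u, smul_zero]
        · exact DirectedGraph.isWalk_append_iff.2 ⟨_, hu, hqv ▸ .cons f (.nil _)⟩
        · intro h
          exact hq (Subtype.ext (Prod.ext (List.append_cancel_right h) (hqv.trans hpv.symm)))
      · rw [pathElt_mul_edge_of_ne S Γ _ hqv, map_zero, smul_zero]
    · intro h; exact absurd hp h
  rw [← key, hf, map_zero, zero_smul]

end Independence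

section Decomposition

variable {S : Type*} [CommSemiring S] {V E : Type*} {Γ : DirectedGraph V E}

/-- Finite sums of vertices are local units, replacing the missing identity. -/
theorem exists_sum_mul_vert (x : LeavittPathAlgebra S Γ) :
    ∃ F₀ : Finset V, ∀ F, F₀ ⊆ F → ∑ v ∈ F, x * vert S Γ v = x := by
  classical
  induction x using gen_induction with
  | zero => exact ⟨∅, by simp⟩
  | add x y hx hy =>
    obtain ⟨F₁, h₁⟩ := hx
    obtain ⟨F₂, h₂⟩ := hy
    refine ⟨F₁ ∪ F₂, fun F hF => ?_⟩
    simp_rw [add_mul]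
    rw [Finset.sum_add_distrib, h₁ F (Finset.union_subset_left hF),
      h₂ F (Finset.union_subset_right hF)]
  | smul k x hx =>
    obtain ⟨F₁, h₁⟩ := hx
    refine ⟨F₁, fun F hF => ?_⟩
    simp_rw [smul_mul_assoc]
    rw [← Finset.smul_sum, h₁ F hF]
  | mul g x hx =>
    obtain ⟨F₁, h₁⟩ := hx
    refine ⟨F₁, fun F hF => ?_⟩
    simp_rw [mul_assoc]
    rw [← Finset.mul_sum, h₁ F hF]
  | gen g =>
    have key (x : LeavittPathAlgebra S Γ) (u : V) (h1 : x * vert S Γ u = x)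
        (h2 : ∀ v, u ≠ v → x * vert S Γ v = 0) :
        ∃ F₀ : Finset V, ∀ F, F₀ ⊆ F → ∑ v ∈ F, x * vert S Γ v = x := by
      refine ⟨{u}, fun F hF => ?_⟩
      rw [Finset.sum_eq_single u (fun v _ hv => h2 v hv.symm), h1]
      exact fun h => absurd (hF (Finset.mem_singleton_self u)) h
    cases g with
    | vertex v => exact key _ v (vert_mul_self S Γ v) fun w h => vert_mul_of_ne S Γ h
    | edge e => exact key _ _ (edge_mul_range S Γ e) fun w h => edge_mul_vert_of_ne S Γ h
    | ghost e => exact key _ _ (ghost_mul_source S Γ e) fun w h => ghost_mul_vert_of_ne S Γ h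

/-- Ideals are not assumed closed under scalars, but a scalar can be moved onto the local unit: `k •
(x v) = x (k • v)`. -/
theorem smul_mem_of_isHemiringIdeal {I : AddSubmonoid (LeavittPathAlgebra S Γ)}
    (hI : IsHemiringIdeal I) (k : S) {x : LeavittPathAlgebra S Γ} (hx : x ∈ I) : k • x ∈ I := by
  obtain ⟨F, hF⟩ := exists_sum_mul_vert x
  rw [← hF F subset_rfl, Finset.smul_sum]
  refine sum_mem fun v _ => ?_
  rw [← mul_smul_comm]
  exact (hI _ _ hx).2

/-- Splitting `x v` into a part without ghost edges and a part ending in ghost edges. -/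
theorem exists_decomposition (x : LeavittPathAlgebra S Γ) (v : V) :
    ∃ b z, b ∈ ghostDegreeLE S Γ 0 ∧ b * vert S Γ v = b ∧ z * vert S Γ v = z ∧
      x * vert S Γ v = b + z ∧
      ∃ F₀ : Finset E, ∀ F, F₀ ⊆ F → ∑ e ∈ F, z * edge S Γ e * ghost S Γ e = z := by
  classical
  obtain ⟨n, hn⟩ := exists_mem_ghostDegreeLE S Γ x
  induction hn using Submodule.span_induction with
  | zero => exact ⟨0, 0, zero_mem _, by simp, by simp, by simp, ∅, by simp⟩
  | add x y _ _ hx hy =>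
    obtain ⟨b, z, h1, h2, h3, h4, F₁, h5⟩ := hx
    obtain ⟨b', z', h1', h2', h3', h4', F₂, h5'⟩ := hy
    refine ⟨b + b', z + z', add_mem h1 h1', by rw [add_mul, h2, h2'], by rw [add_mul, h3, h3'],
      by rw [add_mul, h4, h4']; abel, F₁ ∪ F₂, fun F hF => ?_⟩
    simp_rw [add_mul]
    rw [Finset.sum_add_distrib, h5 F (Finset.union_subset_left hF),
      h5' F (Finset.union_subset_right hF)]
  | smul k x _ hx =>
    obtain ⟨b, z, h1, h2, h3, h4, F₁, h5⟩ := hx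
    refine ⟨k • b, k • z, Submodule.smul_mem _ k h1, by rw [smul_mul_assoc, h2],
      by rw [smul_mul_assoc, h3], by rw [smul_mul_assoc, h4, smul_add], F₁, fun F hF => ?_⟩
    simp_rw [smul_mul_assoc]
    rw [← Finset.smul_sum, h5 F hF]
  | mem x h =>
    obtain ⟨l, l', w, -, rfl⟩ := h
    cases l' with
    | nil =>
      rw [ghostElt_nil, pathElt_mul_vert]
      by_cases h : w = v
      · subst h
        exact ⟨pathElt S Γ l w, 0, pathElt_mem S Γ 0 l w, by simp, by simp, by simp, ∅, by simp⟩
      · rw [pathElt_mul_vert_of_ne S Γ l h]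
        exact ⟨0, 0, zero_mem _, by simp, by simp, by simp, ∅, by simp⟩
    | cons f l' =>
      rw [ghostElt_cons, ← mul_assoc]
      generalize pathElt S Γ l w * ghostElt S Γ l' w = g
      by_cases h : Γ.s f = v
      · subst h
        refine ⟨0, g * ghost S Γ f, zero_mem _, by simp, by simp [mul_assoc],
          by simp [mul_assoc], {f}, fun F hF => ?_⟩
        rw [Finset.sum_eq_single f]
        · simp [mul_assoc]
        · intro e _ he
          rw [mul_assoc g, ghost_mul_edge_of_ne S Γ he.symm, mul_zero, zero_mul]
        · exact fun h => absurd (hF (Finset.mem_singleton_self f)) h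
      · rw [mul_assoc, ghost_mul_vert_of_ne S Γ h, mul_zero]
        exact ⟨0, 0, zero_mem _, by simp, by simp, by simp, ∅, by simp⟩

theorem mul_edge_eq_zero_of_sum {z : LeavittPathAlgebra S Γ} {F : Finset E}
    (h : ∑ e ∈ F, z * edge S Γ e * ghost S Γ e = z) {f : E} (hf : f ∉ F) :
    z * edge S Γ f = 0 := by
  rw [← h, Finset.sum_mul]
  refine Finset.sum_eq_zero fun e he => ?_
  have hef : e ≠ f := by rintro rfl; exact hf he
  rw [mul_assoc, ghost_mul_edge_of_ne S Γ hef, mul_zero]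

/-- A nonzero element annihilated on the right by all edges has a nonzero component without
ghost edges. -/
theorem exists_mul_vert_ne_zero {x : LeavittPathAlgebra S Γ} (hx : x ≠ 0)
    (hedge : ∀ e, x * edge S Γ e = 0) :
    ∃ v, x * vert S Γ v ≠ 0 ∧ x * vert S Γ v ∈ ghostDegreeLE S Γ 0 := by
  obtain ⟨v, hv⟩ : ∃ v, x * vert S Γ v ≠ 0 := by
    by_contra! h
    obtain ⟨F, hF⟩ := exists_sum_mul_vert x
    exact hx (by rw [← hF F subset_rfl, Finset.sum_eq_zero fun v _ => h v])
  have hedge' (e) : x * vert S Γ v * edge S Γ e = 0 := by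
    by_cases h : v = Γ.s e
    · rw [mul_assoc, h, source_mul_edge, hedge]
    · rw [mul_assoc, vert_mul_edge_of_ne S Γ h, mul_zero]
  obtain ⟨b, z, h1, h2, h3, h4, F, h5⟩ := exists_decomposition x v
  -- Without a ghost-free part, `x v = z = ∑ z e e*` with every `z e` zero.
  have hz0 (hb : b = 0) : False := by
    rw [hb, zero_add] at h4
    refine hv ?_
    rw [h4, ← h5 F subset_rfl]
    refine Finset.sum_eq_zero fun e _ => ?_
    rw [← h4, hedge', zero_mul]
  refine ⟨v, hv, ?_⟩
  by_cases hne : (Γ.s ⁻¹' {v}).Nonempty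
  · by_cases hfin : (Γ.s ⁻¹' {v}).Finite
    · refine absurd ?_ hv
      rw [vert_eq_sum S Γ ⟨hne, hfin⟩, Finset.mul_sum]
      refine Finset.sum_eq_zero fun e _ => ?_
      rw [← mul_assoc, hedge, zero_mul]
    -- At an infinite emitter some edge `f` avoids the finitely many ghost edges of `z`. Then `z f =
    -- 0`, so `b f = 0`, which forces `b = 0`.
    · obtain ⟨f, hf, hfF⟩ := Set.Infinite.exists_notMem_finset hfin F
      obtain rfl : Γ.s f = v := hf
      refine (hz0 (eq_zero_of_mul_edge_eq_zero h1 h2 ?_)).elim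
      have := hedge' f
      rwa [h4, add_mul, mul_edge_eq_zero_of_sum (h5 F subset_rfl) hfF, add_zero] at this
  -- No ghost edge can end at a sink.
  · have hz : z = 0 := by
      rw [← h5 F subset_rfl]
      refine Finset.sum_eq_zero fun e _ => ?_
      have : v ≠ Γ.s e := fun h => hne ⟨e, h.symm⟩
      rw [← h3, mul_assoc z, vert_mul_edge_of_ne S Γ this, mul_zero, zero_mul]
    rw [h4, hz, add_zero]
    exact h1

theorem exists_ghostFree_mem {I : AddSubmonoid (LeavittPathAlgebra S Γ)} (hI : IsHemiringIdeal I)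
    {n : ℕ} {x : LeavittPathAlgebra S Γ} (hn : x ∈ ghostDegreeLE S Γ n) (hx : x ∈ I)
    (hx0 : x ≠ 0) : ∃ b ∈ I, b ≠ 0 ∧ b ∈ ghostDegreeLE S Γ 0 := by
  induction n generalizing x with
  | zero => exact ⟨x, hx, hx0, hn⟩
  | succ n ih =>
    by_cases h : ∃ e, x * edge S Γ e ≠ 0
    · obtain ⟨e, he⟩ := h
      exact ih (mul_edge_mem hn e) (hI _ _ hx).2 he
    · push Not at h
      obtain ⟨v, hv, hv'⟩ := exists_mul_vert_ne_zero hx0 h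
      exact ⟨_, (hI _ _ hx).2, hv, hv'⟩

/-- `x` is a multiple of a closed path of positive length at `w`. -/
def IsClosedTerm (w : V) (x : LeavittPathAlgebra S Γ) : Prop :=
  x = 0 ∨ ∃ (k : S) (l : List E), l ≠ [] ∧ Γ.IsWalk w l w ∧ x = k • pathElt S Γ l w

/-- Either `m = l t`, and what remains is the closed path `t`, nonempty because `m ≠ l`, or the
product vanishes. -/
theorem isClosedTerm_ghostElt_mul {l m : List E} {v v' u : V} (hl : Γ.IsWalk v l u)
    (hm : Γ.IsWalk v' m u) (hlen : l.length ≤ m.length) (hne : m ≠ l) (k : S) :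
    IsClosedTerm u (k • (ghostElt S Γ l u * pathElt S Γ m u)) := by
  by_cases hv : v = v'
  · subst hv
    by_cases h : l <+: m
    · obtain ⟨t, rfl⟩ := h
      obtain ⟨u', h1, h2⟩ := DirectedGraph.isWalk_append_iff.1 hm
      obtain rfl := hl.end_unique h1
      refine .inr ⟨k, t, ?_, h2, by rw [ghostElt_mul_pathElt_append S hl h2]⟩
      rintro rfl
      simp at hne
    · left
      rw [ghostElt_mul_pathElt_of_not_prefix S hl hm hlen (.inr h), smul_zero]
  · left
    rw [ghostElt_mul_pathElt_of_not_prefix S hl hm hlen (.inl hv), smul_zero]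

theorem IsClosedTerm.conj {w u : V} {x : LeavittPathAlgebra S Γ} (hx : IsClosedTerm w x)
    {p : List E} (hp : Γ.IsWalk w p u) :
    IsClosedTerm u (ghostElt S Γ p u * x * pathElt S Γ p u) := by
  rcases hx with rfl | ⟨k, l, hl, hw, rfl⟩
  · left; simp
  · rw [mul_smul_comm, smul_mul_assoc, mul_assoc, pathElt_mul_pathElt S hp]
    refine isClosedTerm_ghostElt_mul hp (DirectedGraph.isWalk_append_iff.2 ⟨_, hw, hp⟩) (by simp)
      ?_ k
    simpa using hl

end Decomposition

/-! ### Sufficiency of the two conditions -/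

section Semifield

variable {S : Type*} [Semifield S] {V E : Type*} {Γ : DirectedGraph V E}

/-- Induction on the number of closed terms. Conjugating by a path that leaves the first closed path
kills that term, turns `k w` into `k u`, and sends the other terms to closed terms at `u`. -/
theorem exists_vert_mem_of_add_sum_mem {I : AddSubmonoid (LeavittPathAlgebra S Γ)}
    (hI : IsHemiringIdeal I) (hexit : ∀ p : List E, Γ.IsCycle p → ∃ f : E, Γ.IsExit f p)
    {w : V} {k : S} (hk : k ≠ 0) (xs : List (LeavittPathAlgebra S Γ))
    (hxs : ∀ x ∈ xs, IsClosedTerm w x) (hmem : k • vert S Γ w + xs.sum ∈ I) :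
    ∃ v, vert S Γ v ∈ I := by
  induction hn : xs.length generalizing xs w with
  | zero =>
    obtain rfl := List.length_eq_zero_iff.1 hn
    rw [List.sum_nil, add_zero] at hmem
    have := smul_mem_of_isHemiringIdeal hI k⁻¹ hmem
    rw [smul_smul, inv_mul_cancel₀ hk, one_smul] at this
    exact ⟨w, this⟩
  | succ n ih =>
    obtain ⟨x, xs, rfl⟩ := List.exists_cons_of_length_eq_add_one hn
    rw [List.forall_mem_cons] at hxs
    have hlen : xs.length = n := by simpa using hn
    rcases hxs.1 with rfl | ⟨c, t, ht, hw, rfl⟩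
    · exact ih xs hxs.2 (by simpa using hmem) hlen
    · obtain ⟨p, u, hp, hpre⟩ := hw.exists_not_prefix hexit ht
      have key := (hI (ghostElt S Γ p u) _ (hI (pathElt S Γ p u) _ hmem).2).1
      have h0 : ghostElt S Γ p u * (pathElt S Γ t w * pathElt S Γ p u) = 0 := by
        rw [pathElt_mul_pathElt S hp]
        exact ghostElt_mul_pathElt_of_not_prefix S hp
          (DirectedGraph.isWalk_append_iff.2 ⟨_, hw, hp⟩) (by simp) (.inr hpre)
      have h1 : ghostElt S Γ p u * pathElt S Γ p u = vert S Γ u := by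
        simpa using ghostElt_mul_pathElt_append S hp (.nil u)
      refine ih (w := u) (xs.map fun x => ghostElt S Γ p u * x * pathElt S Γ p u) ?_ ?_ (by simpa using hlen)
      · intro y hy
        obtain ⟨x, hx, rfl⟩ := List.mem_map.1 hy
        exact (hxs.2 x hx).conj hp
      · have h2 : (xs.map fun x => ghostElt S Γ p u * x * pathElt S Γ p u).sum =
            ghostElt S Γ p u * (xs.sum * pathElt S Γ p u) := by
          rw [← mul_assoc, List.sum_map_mul_right, List.sum_map_mul_left, List.map_id']
        rw [h2]
        rwa [List.sum_cons, add_mul, add_mul, mul_add, mul_add, smul_mul_assoc, smul_mul_assoc,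
          mul_smul_comm, mul_smul_comm, h0, smul_zero, zero_add, vert_mul_pathElt S hp, h1] at key

theorem exists_vert_mem {I : AddSubmonoid (LeavittPathAlgebra S Γ)}
    (hI : IsHemiringIdeal I) (hexit : ∀ p : List E, Γ.IsCycle p → ∃ f : E, Γ.IsExit f p)
    (hne : I ≠ ⊥) : ∃ v, vert S Γ v ∈ I := by
  classical
  obtain ⟨x, hx, hx0⟩ : ∃ x ∈ I, x ≠ 0 := by
    by_contra! h
    exact hne ((AddSubmonoid.eq_bot_iff_forall I).2 h)
  obtain ⟨n, hn⟩ := exists_mem_ghostDegreeLE S Γ x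
  obtain ⟨b, hb, hb0, hbn⟩ := exists_ghostFree_mem hI hn hx hx0
  obtain ⟨c, rfl⟩ := exists_finsupp_of_mem hbn
  have hc : c.support.Nonempty := by
    rw [Finset.nonempty_iff_ne_empty]
    intro h
    exact hb0 (by rw [Finsupp.sum, h, Finset.sum_empty])
  -- Minimal length ensures that multiplication by the ghost of this path leaves no ghost edges in
  -- the other terms.
  obtain ⟨p, hp, hmin⟩ := c.support.exists_min_image (fun q => q.1.1.length) hc
  obtain ⟨⟨l, w⟩, v, hw⟩ := p
  dsimp only at hw hmin
  have key := (hI (ghostElt S Γ l w) _ (hI (vert S Γ w) _ hb).2).1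
  rw [Finsupp.sum, Finset.sum_mul, Finset.mul_sum, ← Finset.add_sum_erase _ _ hp,
    ← Finset.sum_map_toList, smul_mul_assoc, pathElt_mul_vert, mul_smul_comm] at key
  have h1 : ghostElt S Γ l w * pathElt S Γ l w = vert S Γ w := by
    simpa using ghostElt_mul_pathElt_append S hw (.nil w)
  rw [h1] at key
  refine exists_vert_mem_of_add_sum_mem hI hexit (Finsupp.mem_support_iff.1 hp) _ ?_ key
  intro y hy
  obtain ⟨⟨⟨l', w'⟩, v', hw'⟩, hq, rfl⟩ := List.mem_map.1 hy
  rw [Finset.mem_toList, Finset.mem_erase] at hq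
  dsimp only at hw' ⊢
  rw [smul_mul_assoc, mul_smul_comm]
  by_cases h : w' = w
  · subst h
    rw [pathElt_mul_vert]
    refine isClosedTerm_ghostElt_mul hw hw' (hmin _ hq.2) ?_ _
    rintro rfl
    exact hq.1 rfl
  · left
    rw [pathElt_mul_vert_of_ne S Γ _ h, mul_zero, smul_zero]

theorem eq_top_of_vert_mem {I : AddSubmonoid (LeavittPathAlgebra S Γ)} (hI : IsHemiringIdeal I)
    (h : ∀ v, vert S Γ v ∈ I) : I = ⊤ := by
  refine (AddSubmonoid.eq_top_iff' I).2 fun x => ?_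
  obtain ⟨F, hF⟩ := exists_sum_mul_vert x
  rw [← hF F subset_rfl]
  exact sum_mem fun v _ => (hI _ _ (h v)).1

theorem isIdealSimple_of_conditions
    (hH : ∀ H : Set V, Γ.IsHereditary H → Γ.IsSaturated H → H = ∅ ∨ H = Set.univ)
    (hexit : ∀ p : List E, Γ.IsCycle p → ∃ f : E, Γ.IsExit f p) :
    IsIdealSimple (LeavittPathAlgebra S Γ) := by
  intro I hI
  by_cases hne : I = ⊥
  · exact .inl hne
  right
  obtain ⟨v, hv⟩ := exists_vert_mem hI hexit hne
  refine eq_top_of_vert_mem hI fun w => ?_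
  have := hH {v | vert S Γ v ∈ I} ?_ ?_
  · rcases this with h | h
    · exact (Set.eq_empty_iff_forall_notMem.1 h v hv).elim
    · exact Set.eq_univ_iff_forall.1 h w
  · intro e he
    have := (hI (ghost S Γ e) _ (hI (edge S Γ e) _ he).2).1
    rwa [source_mul_edge, ghost_mul_edge_self] at this
  · intro u hu hsub
    change vert S Γ u ∈ I
    rw [vert_eq_sum S Γ hu]
    refine sum_mem fun e he => ?_
    have hr : vert S Γ (Γ.r e) ∈ I := hsub ⟨e, by simpa using he, rfl⟩
    rw [← edge_mul_range, mul_assoc]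
    exact (hI _ _ (hI _ _ hr).2).1

end Semifield

end LeavittPathAlgebra

/-! ### The branching system of a cycle without exits -/

namespace DirectedGraph

variable {V E : Type*} (Γ : DirectedGraph V E)

open scoped Classical in
/-- The start vertex of a path that ends at `v₀` and does not visit `v₀` before its end. -/
noncomputable def firstHitSource (v₀ : V) : List E → Option V
  | [] => some v₀
  | e :: l =>
    if Γ.s e ≠ v₀ ∧ firstHitSource v₀ l = some (Γ.r e) then some (Γ.s e) else none

variable {Γ}

theorem firstHitSource_cons_eq_some {v₀ v : V} {e : E} {l : List E} :
    Γ.firstHitSource v₀ (e :: l) = some v ↔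
      Γ.s e ≠ v₀ ∧ Γ.firstHitSource v₀ l = some (Γ.r e) ∧ Γ.s e = v := by
  rw [firstHitSource]
  split_ifs with h
  · simp [h.1, h.2]
  · simp only [false_iff]; tauto

theorem firstHitSource_eq_some_self {v₀ : V} {l : List E} :
    Γ.firstHitSource v₀ l = some v₀ ↔ l = [] := by
  cases l with
  | nil => simp [firstHitSource]
  | cons e l => rw [firstHitSource_cons_eq_some]; simp only [reduceCtorEq, iff_false]; tauto

theorem IsWalk.firstHitSource_eq {v v₀ : V} {q : List E} (h : Γ.IsWalk v q v₀)
    (hq : ∀ e ∈ q, Γ.s e ≠ v₀) : Γ.firstHitSource v₀ q = some v := by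
  generalize hw : v₀ = w at h hq
  subst hw
  induction q generalizing v with
  | nil => rw [isWalk_nil_iff.1 h]; rfl
  | cons e q ih =>
    rw [List.forall_mem_cons] at hq
    obtain ⟨h1, h2⟩ := isWalk_cons_iff.1 h
    exact firstHitSource_cons_eq_some.2 ⟨hq.1, ih h2 hq.2, h1⟩

/-- Along `q` every next edge is forced, and neither list can stop before the other since `v₀`
occurs only at the end. -/
theorem IsWalk.eq_of_firstHitSource {v v₀ : V} {q l : List E} (h : Γ.IsWalk v q v₀)
    (hq : ∀ e ∈ q, Γ.s e ≠ v₀) (huniq : ∀ e ∈ q, ∀ f, Γ.s f = Γ.s e → f = e)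
    (hl : Γ.firstHitSource v₀ l = some v) : l = q := by
  induction q generalizing v l with
  | nil => rw [isWalk_nil_iff.1 h] at hl; exact firstHitSource_eq_some_self.1 hl
  | cons e q ih =>
    rw [List.forall_mem_cons] at hq huniq
    obtain ⟨rfl, h2⟩ := isWalk_cons_iff.1 h
    cases l with
    | nil => exact absurd (Option.some.inj hl).symm hq.1
    | cons f l =>
      obtain ⟨-, h3, h4⟩ := firstHitSource_cons_eq_some.1 hl
      obtain rfl := huniq.1 f h4
      rw [ih h2 hq.2 huniq.2 h3]

open scoped Classical in
/-- The branching system of the paths that end at the base point of a cycle without exits, and do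
not visit it before. -/
noncomputable def cycleBranchingSystem {e₀ : E} {q : List E} (hw : Γ.IsWalk (Γ.r e₀) q (Γ.s e₀))
    (hq : ∀ e ∈ q, Γ.s e ≠ Γ.s e₀) (huniq : ∀ e ∈ e₀ :: q, ∀ f, Γ.s f = Γ.s e → f = e) :
    BranchingSystem Γ (List E) where
  src := Γ.firstHitSource (Γ.s e₀)
  head
    | [] => some e₀
    | e :: l => if Γ.firstHitSource (Γ.s e₀) (e :: l) = none then none else some e
  tail
    | [] => q
    | _ :: l => l
  pre e l := if Γ.s e = Γ.s e₀ then [] else e :: l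
  src_pre e y h := by
    split_ifs with he
    · rw [he]; rfl
    · exact firstHitSource_cons_eq_some.2 ⟨he, h, rfl⟩
  -- The empty list stands for the infinite path that goes around the cycle forever: it starts with
  -- `e₀`, and removing `e₀` leaves `q`. Accordingly `pre` returns to `[]` whenever an edge from the
  -- base point is prefixed.
  head_pre e y h := by
    by_cases he : Γ.s e = Γ.s e₀
    · simp [(List.forall_mem_cons.1 huniq).1 e he]
    · simp [he, firstHitSource_cons_eq_some.2 ⟨he, h, rfl⟩]
  tail_pre e y h := by
    by_cases he : Γ.s e = Γ.s e₀
    · obtain rfl := (List.forall_mem_cons.1 huniq).1 e he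
      simpa using (hw.eq_of_firstHitSource hq (List.forall_mem_cons.1 huniq).2 h).symm
    · simp [he]
  src_of_head e y h := by
    cases y with
    | nil => obtain rfl := Option.some.inj h; rfl
    | cons f l =>
      dsimp only at h
      split_ifs at h with h'
      obtain rfl := Option.some.inj h
      obtain ⟨v, hv⟩ := Option.ne_none_iff_exists'.1 h'
      rw [hv, (firstHitSource_cons_eq_some.1 hv).2.2]
  src_tail e y h := by
    cases y with
    | nil => obtain rfl := Option.some.inj h; exact hw.firstHitSource_eq hq
    | cons f l =>
      dsimp only at h
      split_ifs at h with h'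
      obtain rfl := Option.some.inj h
      obtain ⟨v, hv⟩ := Option.ne_none_iff_exists'.1 h'
      exact (firstHitSource_cons_eq_some.1 hv).2.1
  pre_tail e y h := by
    cases y with
    | nil => obtain rfl := Option.some.inj h; simp
    | cons f l =>
      dsimp only at h
      split_ifs at h with h'
      obtain rfl := Option.some.inj h
      obtain ⟨v, hv⟩ := Option.ne_none_iff_exists'.1 h'
      simp [(firstHitSource_cons_eq_some.1 hv).1]
  head_ne_none v y _ h := by
    cases y with
    | nil => simp
    | cons f l => simp [h]

end DirectedGraph

/-- Clearing denominators gives `(1 + X ^ n) f = X ^ m`. Comparing lowest and highest degrees, `f`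
has trailing degree `m` and degree `m - n < m`, which is impossible. -/
theorem LaurentPolynomial.one_add_T_mul_ne_one {S : Type*} [Semifield S] {n : ℕ} (hn : n ≠ 0)
    (g : S[T;T⁻¹]) : (1 + T n) * g ≠ 1 := by
  intro h
  obtain ⟨m, f, hf⟩ := exists_T_pow g
  have h1 : ((1 : Polynomial S) + Polynomial.X ^ n) * f = Polynomial.X ^ m := by
    apply Polynomial.toLaurent_injective
    rw [map_mul, map_add, hf, map_one, Polynomial.toLaurent_X_pow, Polynomial.toLaurent_X_pow,
      ← mul_assoc, h, one_mul]
  have hf0 : f ≠ 0 := by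
    rintro rfl
    rw [mul_zero] at h1
    exact pow_ne_zero m Polynomial.X_ne_zero h1.symm
  have hdeg : (1 + Polynomial.X ^ n : Polynomial S).natDegree = n := by
    rw [add_comm, ← Polynomial.C_1, Polynomial.natDegree_X_pow_add_C]
  have hX : (1 + Polynomial.X ^ n : Polynomial S).coeff 0 = 1 := by
    simp [Polynomial.coeff_X_pow, hn.symm]
  have hX0 : (1 + Polynomial.X ^ n : Polynomial S) ≠ 0 := by
    intro h0; rw [h0] at hX; simp at hX
  have htr : (1 + Polynomial.X ^ n : Polynomial S).natTrailingDegree = 0 :=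
    Polynomial.natTrailingDegree_eq_zero.2 (.inr (by rw [hX]; exact one_ne_zero))
  have h2 := congrArg Polynomial.natDegree h1
  have h3 := congrArg Polynomial.natTrailingDegree h1
  rw [Polynomial.natDegree_mul hX0 hf0, hdeg, Polynomial.natDegree_X_pow] at h2
  rw [Polynomial.natTrailingDegree_mul hX0 hf0, htr, zero_add, ← one_mul (Polynomial.X ^ m),
    Polynomial.natTrailingDegree_mul_X_pow one_ne_zero, Polynomial.natTrailingDegree_one] at h3
  have := f.natTrailingDegree_le_natDegree
  omega

/-! ### Necessity of the two conditions -/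

namespace LeavittPathAlgebra

variable {S : Type*} [Semifield S] {V E : Type*} {Γ : DirectedGraph V E}

theorem eq_empty_or_univ_of_isIdealSimple (h : IsIdealSimple (LeavittPathAlgebra S Γ)) {H : Set V}
    (hH : Γ.IsHereditary H) (hS : Γ.IsSaturated H) : H = ∅ ∨ H = Set.univ := by
  obtain ⟨B, h1, h2⟩ := exists_branchingSystem Γ hH hS
  have hmem (x) : x ∈ AddMonoidHom.mker (B.rep S) ↔ B.rep S x = 0 := Iff.rfl
  have hideal : IsHemiringIdeal (AddMonoidHom.mker (B.rep S)) := by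
    intro x a ha
    rw [hmem] at ha
    rw [hmem, hmem, map_mul, map_mul, ha, mul_zero, zero_mul]
    exact ⟨rfl, rfl⟩
  rcases h _ hideal with hI | hI
  · left
    refine Set.eq_empty_iff_forall_notMem.2 fun v hv => vert_ne_zero S (Γ := Γ) v ?_
    rw [← AddSubmonoid.mem_bot, ← hI, hmem]
    refine LinearMap.ext fun f => funext fun y => ?_
    rw [B.rep_vert, if_neg (h2 v hv y)]
    rfl
  · right
    refine Set.eq_univ_iff_forall.2 fun v => ?_
    by_contra hv
    obtain ⟨y, hy⟩ := h1 v hv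
    have h0 : B.rep S (vert S Γ v) = 0 := (hmem _).1 (hI ▸ AddSubmonoid.mem_top _)
    have := B.rep_vert S v 1 y
    rw [h0, if_pos hy] at this
    exact zero_ne_one this

/-- The elements that act on the functions on a branching system with image in the multiples
of `k`. -/
def imageIdeal {Y : Type*} (B : BranchingSystem Γ Y) (k : S[T;T⁻¹]) :
    AddSubmonoid (LeavittPathAlgebra S Γ) where
  carrier := {x | ∀ m, ∃ m', B.rep S x m = k • m'}
  zero_mem' m := ⟨0, by simp⟩
  add_mem' {x y} hx hy m := by
    obtain ⟨m₁, h₁⟩ := hx m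
    obtain ⟨m₂, h₂⟩ := hy m
    exact ⟨m₁ + m₂, by rw [map_add, LinearMap.add_apply, h₁, h₂, smul_add]⟩

/-- Left multiplication preserves multiples of `k` because the algebra acts by `S[T;T⁻¹]`-linear
maps. -/
theorem isHemiringIdeal_imageIdeal {Y : Type*} (B : BranchingSystem Γ Y) (k : S[T;T⁻¹]) :
    IsHemiringIdeal (imageIdeal B k) := by
  intro x a ha
  refine ⟨fun m => ?_, fun m => ?_⟩
  · obtain ⟨m', hm'⟩ := ha m
    exact ⟨B.rep S x m', by rw [map_mul, Module.End.mul_apply, hm', map_smul]⟩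
  · rw [map_mul, Module.End.mul_apply]
    exact ha _

theorem exists_exit_of_isIdealSimple (h : IsIdealSimple (LeavittPathAlgebra S Γ)) {p : List E}
    (hp : Γ.IsCycle p) : ∃ f, Γ.IsExit f p := by
  by_contra hex
  obtain ⟨⟨hne, hchain⟩, hclosed, hnodup⟩ := hp
  have huniq : ∀ e ∈ p, ∀ f, Γ.s f = Γ.s e → f = e := fun e he f hf => by
    by_contra hfe
    exact hex ⟨f, e, he, hf, hfe⟩
  have hwalk := DirectedGraph.isWalk_of_isChain hne hchain
  rw [hclosed hne] at hwalk
  cases p with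
  | nil => exact hne rfl
  | cons e₀ q =>
  rw [List.head_cons] at hwalk
  have hw := (DirectedGraph.isWalk_cons_iff.1 hwalk).2
  have hq : ∀ e ∈ q, Γ.s e ≠ Γ.s e₀ := fun e he hs => by
    rw [List.map_cons, List.nodup_cons] at hnodup
    exact hnodup.1 (List.mem_map.2 ⟨e, he, hs⟩)
  let B := DirectedGraph.cycleBranchingSystem hw hq huniq
  have hsrc (y) : B.src y = some (Γ.s e₀) ↔ y = [] := DirectedGraph.firstHitSource_eq_some_self
  -- Going once around the cycle fixes the point `[]`, so the cycle acts there as `T ^ n`.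
  have hpre : B.preList (e₀ :: q) [] = [] := by
    rw [BranchingSystem.preList_cons]
    exact if_pos rfl
  set c : LeavittPathAlgebra S Γ := vert S Γ (Γ.s e₀) + pathElt S Γ (e₀ :: q) (Γ.s e₀) with hc
  set k : S[T;T⁻¹] := 1 + LaurentPolynomial.T (e₀ :: q).length with hk
  have hunit (g : S[T;T⁻¹]) : k * g ≠ 1 := LaurentPolynomial.one_add_T_mul_ne_one (by simp) g
  have hact (m) : B.rep S c m = k • B.rep S (vert S Γ (Γ.s e₀)) m := by
    refine funext fun y => ?_
    by_cases hy : y = []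
    · subst hy
      have := B.rep_pathElt_preList S hwalk ((hsrc []).2 rfl) m
      rw [hpre] at this
      rw [hc, map_add, LinearMap.add_apply, Pi.add_apply, this, Pi.smul_apply, B.rep_vert,
        if_pos ((hsrc []).2 rfl), smul_eq_mul, hk, add_mul, one_mul]
    · have hz (x) (f : List E → S[T;T⁻¹]) : B.rep S (vert S Γ (Γ.s e₀) * x) f y = 0 := by
        rw [map_mul, Module.End.mul_apply, B.rep_vert, if_neg (mt (hsrc y).1 hy)]
      have h1 : c = vert S Γ (Γ.s e₀) * c := by
        rw [hc, mul_add, vert_mul_self, vert_mul_pathElt S hwalk]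
      rw [h1, hz, Pi.smul_apply, ← vert_mul_self, hz, smul_zero]
  have hval : B.rep S (vert S Γ (Γ.s e₀)) 1 [] = 1 := by
    rw [B.rep_vert, if_pos ((hsrc []).2 rfl)]
    rfl
  rcases h _ (isHemiringIdeal_imageIdeal B k) with hI | hI
  -- If the ideal were zero, then `c = 0` and hence `k = 0`, but the constant coefficient of `k` is
  -- `1`.
  · have hmem : c ∈ imageIdeal B k := fun m => ⟨_, hact m⟩
    rw [hI, AddSubmonoid.mem_bot] at hmem
    have h0 := congrFun (hact 1) []
    rw [hmem, map_zero, Pi.smul_apply, hval, smul_eq_mul, mul_one] at h0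
    have h1 : (k.coeff 0 : S) = 1 := by
      rw [hk, ← LaurentPolynomial.T_zero]
      simp [-LaurentPolynomial.T_zero, show ((q.length : ℤ) + 1) ≠ 0 by omega]
    rw [← h0] at h1
    exact zero_ne_one h1
  -- If the ideal were everything, the base vertex applied to the constant function `1` would show
  -- at `[]` that `k` divides `1`.
  · have hmem : vert S Γ (Γ.s e₀) ∈ imageIdeal B k := hI ▸ AddSubmonoid.mem_top _
    obtain ⟨m', hm'⟩ := hmem 1
    have h0 := congrFun hm' []
    rw [hval, Pi.smul_apply, smul_eq_mul] at h0
    exact hunit _ h0.symm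

end LeavittPathAlgebra

theorem theorem3p4 {S : Type*} [Semifield S] {V E : Type*} (Γ : DirectedGraph V E) :
    IsIdealSimple (LeavittPathAlgebra S Γ) ↔
      (∀ H : Set V, Γ.IsHereditary H → Γ.IsSaturated H → H = ∅ ∨ H = Set.univ) ∧
      (∀ p : List E, Γ.IsCycle p → ∃ f : E, Γ.IsExit f p) :=
  ⟨fun h => ⟨fun _ hH hS => LeavittPathAlgebra.eq_empty_or_univ_of_isIdealSimple h hH hS,
    fun _ hp => LeavittPathAlgebra.exists_exit_of_isIdealSimple h hp⟩,
    fun h => LeavittPathAlgebra.isIdealSimple_of_conditions h.1 h.2⟩
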